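/- Let $N \ge 1$, let $\mathbf{x}_1,\dots,\mathbf{x}_N \in \mathbb{R}^2$ be distinct points and let $\alpha_1,\dots,\alpha_N \in (0,1)$. For $\mathbf{v} = (v_1,v_2) \in \mathbb{R}^2$ put $\mathbf{v}^\perp = (-v_2, v_1)$, and let $\mathbf{A}_n(\mathbf{x}) = \alpha_n \frac{(\mathbf{x}-\mathbf{x}_n)^\perp}{|\mathbf{x}-\mathbf{x}_n|^2}$. Consider the quadratic form $$Q_N[\psi] = \Big\| \Big(-i\nabla + \sum_{n=1}^N \mathbf{A}_n\Big)\psi \Big\|_{L^2}^2, \qquad \psi \in C_c^\infty(\mathbb{R}^2\setminus\{\mathbf{x}_1,\dots,\mathbf{x}_N\}),$$ let $Q_N^{(\mathrm{F})}$ be its closure in $L^2(\mathbb{R}^2)$ (with domain the closure of $C_c^\infty(\mathbb{R}^2\setminus\{\mathbf{x}_1,\dots,\mathbf{x}_N\})$ in the norm $(\|\psi\|_{L^2}^2 + Q_N[\psi])^{1/2}$), and let $H_N^{(\mathrm{F})}$, the Friedrichs realization of $(-i\nabla + \sum_n \mathbf{A}_n)^2$, be the self-adjoint operator in $L^2(\mathbb{R}^2)$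 associated with $Q_N^{(\mathrm{F})}$. Then $$\sigma_{\mathrm{ess}}\big(H_N^{(\mathrm{F})}\big) = [0,+\infty), \qquad \sigma_{\mathrm{disc}}\big(H_N^{(\mathrm{F})}\big) = \varnothing.$$ Here $\sigma_{\mathrm{disc}}$ is the set of isolated points of the spectrum that are eigenvalues of finite multiplicity, and $\sigma_{\mathrm{ess}}$ is the rest of the spectrum. -/

import Mathlib

open MeasureTheory
open scoped ContDiff

noncomputable section

namespace AharonovBohm

/-- The plane `ℝ²` with its Euclidean norm. -/
abbrev Plane : Type := EuclideanSpace ℝ (Fin 2)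

/-- The Hilbert space `L²(ℝ²; ℂ)` for the Lebesgue measure. -/
abbrev L2 : Type := Lp ℂ 2 (volume : Measure Plane)

/-- The rotated vector `(x, y)^⊥ = (-y, x)`. -/
def perp (v : Plane) : Plane := !₂[-(v 1), v 0]

/-- The Aharonov–Bohm potential `α (x - p)^⊥ / |x - p|²` of one flux of intensity `α` at `p`. -/
def fluxPotential (α : ℝ) (p x : Plane) : Plane := (α / ‖x - p‖ ^ 2) • perp (x - p)

/-- The total vector potential `∑ₙ Aₙ`. -/
def potential {N : ℕ} (α : Fin N → ℝ) (pos : Fin N → Plane) (x : Plane) : Plane :=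
  ∑ n, fluxPotential (α n) (pos n) x

/-- `φ ∈ C_c^∞(ℝ² ∖ {x₁, …, x_N}; ℂ)`. -/
structure IsTestFunction {N : ℕ} (pos : Fin N → Plane) (φ : Plane → ℂ) : Prop where
  contDiff : ContDiff ℝ ∞ φ
  hasCompactSupport : HasCompactSupport φ
  notMem_tsupport : ∀ n, pos n ∉ tsupport φ

/-- The `j`-th component of the magnetic gradient `(-i∇ + ∑ₙ Aₙ) φ`. -/
def magGradient {N : ℕ} (α : Fin N → ℝ) (pos : Fin N → Plane) (φ : Plane → ℂ) (j : Fin 2)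
    (x : Plane) : ℂ :=
  -Complex.I * fderiv ℝ φ x (EuclideanSpace.single j 1) + (potential α pos x j : ℂ) * φ x

/-- The graph in `L² × (L²)²` of the magnetic gradient on test functions. The quadratic form
`Q_N[φ] = ‖(-i∇ + ∑ₙ Aₙ) φ‖²` is the squared norm of the second component, and
`‖φ‖² + Q_N[φ]` is the squared graph norm. -/
def minimalGraph {N : ℕ} (α : Fin N → ℝ) (pos : Fin N → Plane) :
    Submodule ℂ (L2 × (Fin 2 → L2)) where
  carrier := {p | ∃ φ : Plane → ℂ, IsTestFunction pos φ ∧ p.1 =ᵐ[volume] φ ∧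
    ∀ j, p.2 j =ᵐ[volume] magGradient α pos φ j}
  zero_mem' := by
    refine ⟨fun _ => 0, ⟨contDiff_const, HasCompactSupport.zero, fun n => ?_⟩,
      Lp.coeFn_zero _ _ _, fun j => ?_⟩
    · simp [tsupport]
    · filter_upwards [Lp.coeFn_zero ℂ 2 (volume : Measure Plane)] with x hx
      simp [magGradient]
  add_mem' := by
    rintro p q ⟨φ, hφ, h1, h2⟩ ⟨ψ, hψ, k1, k2⟩
    refine ⟨φ + ψ, ⟨hφ.1.add hψ.1, hφ.2.add hψ.2, fun n hn => ?_⟩, ?_, fun j => ?_⟩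
    · rcases tsupport_add φ ψ hn with h | h
      · exact hφ.3 n h
      · exact hψ.3 n h
    · exact (Lp.coeFn_add p.1 q.1).trans (h1.add k1)
    · filter_upwards [Lp.coeFn_add (p.2 j) (q.2 j), h2 j, k2 j] with x hx hx1 hx2
      have hd : fderiv ℝ (φ + ψ) x = fderiv ℝ φ x + fderiv ℝ ψ x :=
        fderiv_add (hφ.1.differentiable (by simp) x) (hψ.1.differentiable (by simp) x)
      simp only [Prod.snd_add, Pi.add_apply] at hx ⊢
      rw [hx, hx1, hx2]
      simp only [magGradient, hd, add_apply, Pi.add_apply]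
      ring
  smul_mem' := by
    rintro c p ⟨φ, hφ, h1, h2⟩
    have hs : tsupport (c • φ) ⊆ tsupport φ :=
      closure_mono (Function.support_const_smul_subset c φ)
    refine ⟨c • φ, ⟨contDiff_const.smul hφ.1, hφ.2.mono (Function.support_const_smul_subset c φ),
      fun n hn => hφ.3 n (hs hn)⟩, ?_, fun j => ?_⟩
    · exact (Lp.coeFn_smul c p.1).trans (h1.const_smul c)
    · filter_upwards [Lp.coeFn_smul c (p.2 j), h2 j] with x hx hx1
      have hd : fderiv ℝ (c • φ) x = c • fderiv ℝ φ x :=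
        fderiv_const_smul (hφ.1.differentiable (by simp) x) c
      rw [show (c • p).2 j = c • p.2 j from rfl, hx, Pi.smul_apply, hx1]
      simp only [magGradient, hd, smul_apply, Pi.smul_apply, smul_eq_mul]
      ring

/-- The closure of `minimalGraph`: the pairs `(ψ, v)` with `ψ` in the closure of the test functions
for the norm `(‖ψ‖² + Q_N[ψ])^{1/2}` and `v = (-i∇ + ∑ₙ Aₙ) ψ`. -/
def formGraph {N : ℕ} (α : Fin N → ℝ) (pos : Fin N → Plane) :
    Submodule ℂ (L2 × (Fin 2 → L2)) :=
  (minimalGraph α pos).topologicalClosure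

/-- The form domain `𝒟[Q_N^{(F)}]`. -/
def formDomain {N : ℕ} (α : Fin N → ℝ) (pos : Fin N → Plane) : Submodule ℂ L2 :=
  (formGraph α pos).map (LinearMap.fst ℂ L2 (Fin 2 → L2))

/-- The graph of the operator associated with the closed form `Q_N^{(F)}`: the pairs `(ψ, w)` with
`ψ ∈ 𝒟[Q_N^{(F)}]` and `Q_N^{(F)}[χ, ψ] = ⟨χ, w⟩` for all `χ ∈ 𝒟[Q_N^{(F)}]`, where
`Q_N^{(F)}[χ, ψ] = ∑ⱼ ⟨uⱼ, vⱼ⟩` for the magnetic gradients `u` of `χ` and `v` of `ψ`. -/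
def friedrichsGraph {N : ℕ} (α : Fin N → ℝ) (pos : Fin N → Plane) : Submodule ℂ (L2 × L2) where
  carrier := {p | ∃ v, (p.1, v) ∈ formGraph α pos ∧ ∀ χ u, (χ, u) ∈ formGraph α pos →
    ∑ j, inner ℂ (u j) (v j) = inner ℂ χ p.2}
  zero_mem' := ⟨0, (formGraph α pos).zero_mem, fun χ u _ => by simp⟩
  add_mem' := by
    rintro p q ⟨v, hv, h⟩ ⟨v', hv', h'⟩
    refine ⟨v + v', (formGraph α pos).add_mem hv hv', fun χ u hu => ?_⟩
    simp only [Pi.add_apply, inner_add_right, Finset.sum_add_distrib, Prod.snd_add, h χ u hu,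
      h' χ u hu]
  smul_mem' := by
    rintro c p ⟨v, hv, h⟩
    refine ⟨c • v, (formGraph α pos).smul_mem c hv, fun χ u hu => ?_⟩
    simp only [Pi.smul_apply, inner_smul_right, ← Finset.mul_sum, Prod.smul_snd, h χ u hu]

lemma continuous_magGradient {N : ℕ} (α : Fin N → ℝ) (pos : Fin N → Plane) {φ : Plane → ℂ}
    (hφ : IsTestFunction pos φ) (j : Fin 2) : Continuous (magGradient α pos φ j) := by
  have h1 : Continuous fun x => fderiv ℝ φ x (EuclideanSpace.single j 1) :=
    (hφ.1.continuous_fderiv (by simp)).clm_apply continuous_const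
  have h2 : Continuous fun x => (potential α pos x j : ℂ) * φ x := by
    refine continuous_iff_continuousAt.2 fun x => ?_
    by_cases hx : x ∈ tsupport φ
    · have hn : ∀ n, ‖x - pos n‖ ^ 2 ≠ 0 := fun n h => by
        have h0 : x = pos n := by simpa [sub_eq_zero] using h
        exact hφ.3 n (h0 ▸ hx)
      have hp : ContinuousAt (fun x => (potential α pos x j : ℂ)) x := by
        refine Complex.continuous_ofReal.continuousAt.comp ?_
        have he : (fun x => potential α pos x j) =
            fun x => ∑ n, (α n / ‖x - pos n‖ ^ 2) * perp (x - pos n) j := by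
          funext y
          simp [potential, fluxPotential]
        rw [he]
        have hperp : ∀ n, Continuous fun y : Plane => perp (y - pos n) j := by
          intro n
          fin_cases j <;> simp [perp] <;> fun_prop
        refine tendsto_finsetSum _ fun n _ => ?_
        refine ContinuousAt.mul (ContinuousAt.div continuousAt_const ?_ (hn n))
          (hperp n).continuousAt
        fun_prop
      exact hp.mul hφ.1.continuous.continuousAt
    · have h0 : (fun x => (potential α pos x j : ℂ) * φ x) =ᶠ[nhds x] fun _ => 0 := by
        filter_upwards [notMem_tsupport_iff_eventuallyEq.1 hx] with y hy
        simp [hy]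
      exact continuousAt_const.congr h0.symm
  exact (continuous_const.mul h1).add h2

lemma hasCompactSupport_magGradient {N : ℕ} (α : Fin N → ℝ) (pos : Fin N → Plane) {φ : Plane → ℂ}
    (hφ : IsTestFunction pos φ) (j : Fin 2) : HasCompactSupport (magGradient α pos φ j) := by
  refine hφ.2.of_isClosed_subset (isClosed_tsupport _) (closure_minimal ?_ (isClosed_tsupport φ))
  intro x hx
  by_contra hn
  have h := notMem_tsupport_iff_eventuallyEq.1 hn
  apply hx
  simp [magGradient, h.fderiv_eq, h.eq_of_nhds]

/-- The relation `friedrichsGraph` is single-valued, so that it is the graph of an operator. -/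
lemma friedrichsGraph_singleValued {N : ℕ} (α : Fin N → ℝ) (pos : Fin N → Plane) (p : L2 × L2)
    (hp : p ∈ friedrichsGraph α pos) (h0 : p.1 = 0) : p.2 = 0 := by
  obtain ⟨v, hv, h⟩ := hp
  rw [h0] at hv
  have hv0 : v = 0 := by
    have hs := h 0 v hv
    rw [inner_zero_left] at hs
    have hs' : ∑ j, ‖v j‖ ^ 2 = 0 := by
      have : ((∑ j, ‖v j‖ ^ 2 : ℝ) : ℂ) = 0 := by
        rw [← hs]
        push_cast
        exact Finset.sum_congr rfl fun j _ => (inner_self_eq_norm_sq_to_K (v j)).symm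
      exact_mod_cast this
    funext j
    have := (Finset.sum_eq_zero_iff_of_nonneg (fun j _ => by positivity)).1 hs' j
      (Finset.mem_univ j)
    simpa using this
  subst hv0
  have hU : IsOpen (Set.range pos)ᶜ := (Set.finite_range pos).isClosed.isOpen_compl
  have hw : LocallyIntegrable p.2 (volume : Measure Plane) :=
    (Lp.memLp p.2).locallyIntegrable (by norm_num)
  have hae : ∀ᵐ x ∂(volume : Measure Plane), x ∈ (Set.range pos)ᶜ → p.2 x = 0 := by
    refine hU.ae_eq_zero_of_integral_contDiff_smul_eq_zero (hw.locallyIntegrableOn _) ?_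
    intro g hg hgc hgs
    have hφ : IsTestFunction pos fun x => (g x : ℂ) := by
      have hsup : tsupport (fun x => (g x : ℂ)) ⊆ tsupport g :=
        closure_mono fun x hx hgx => hx (by simp [hgx])
      exact ⟨Complex.ofRealCLM.contDiff.comp hg,
        hgc.of_isClosed_subset (isClosed_tsupport _) hsup,
        fun n hn => hgs (hsup hn) ⟨n, rfl⟩⟩
    have hm := hφ.1.continuous.memLp_of_hasCompactSupport (p := 2) (μ := volume) hφ.2
    have hd := fun j => (continuous_magGradient α pos hφ j).memLp_of_hasCompactSupport (p := 2)
      (μ := volume) (hasCompactSupport_magGradient α pos hφ j)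
    have hmem : (hm.toLp, fun j => (hd j).toLp) ∈ formGraph α pos :=
      (minimalGraph α pos).le_topologicalClosure
        ⟨_, hφ, hm.coeFn_toLp, fun j => (hd j).coeFn_toLp⟩
    have hi := h _ _ hmem
    simp only [Pi.zero_apply, inner_zero_right, Finset.sum_const_zero] at hi
    rw [L2.inner_def] at hi
    rw [hi]
    refine integral_congr_ae ?_
    filter_upwards [hm.coeFn_toLp] with x hx
    rw [hx]
    simp [mul_comm]
  refine (Lp.eq_zero_iff_ae_eq_zero).2 ?_
  have hnull : ∀ᵐ x ∂(volume : Measure Plane), x ∈ (Set.range pos)ᶜ :=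
    measure_eq_zero_iff_ae_notMem.1 ((Set.finite_range pos).measure_zero volume)
  filter_upwards [hae, hnull] with x h1 h2
  exact h1 h2

/-- The Friedrichs realization `H_N^{(F)}`, an unbounded operator in `L²(ℝ²)`. -/
def friedrichs {N : ℕ} (α : Fin N → ℝ) (pos : Fin N → Plane) : L2 →ₗ.[ℂ] L2 :=
  (friedrichsGraph α pos).toLinearPMap

lemma graph_friedrichs {N : ℕ} (α : Fin N → ℝ) (pos : Fin N → Plane) :
    (friedrichs α pos).graph = friedrichsGraph α pos :=
  Submodule.toLinearPMap_graph_eq _ (friedrichsGraph_singleValued α pos)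

end AharonovBohm

namespace UnboundedOperator

variable {H : Type*} [NormedAddCommGroup H] [InnerProductSpace ℂ H]

/-- `R` is a bounded two-sided inverse of `T - z : 𝒟(T) → H`. -/
def IsResolventAt (T : H →ₗ.[ℂ] H) (z : ℂ) (R : H →L[ℂ] H) : Prop :=
  (∀ f : H, ∃ h : R f ∈ T.domain, T ⟨R f, h⟩ - z • R f = f) ∧
    ∀ ψ : T.domain, R (T ψ - z • (ψ : H)) = ψ

/-- The spectrum `σ(T)`: the `z` for which `T - z` has no bounded inverse. -/
def spectrum (T : H →ₗ.[ℂ] H) : Set ℂ := {z | ¬ ∃ R, IsResolventAt T z R}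

/-- The eigenspace `ker (T - z)`. -/
def eigenspace (T : H →ₗ.[ℂ] H) (z : ℂ) : Submodule ℂ H :=
  T.graph.comap (LinearMap.id.prod (z • LinearMap.id))

/-- The discrete spectrum of a self-adjoint operator: the isolated points of the spectrum that are
eigenvalues of finite multiplicity. -/
def discreteSpectrum (T : H →ₗ.[ℂ] H) : Set ℂ :=
  {z | z ∈ spectrum T ∧ (∃ ε > 0, ∀ w ∈ spectrum T, dist w z < ε → w = z) ∧
    eigenspace T z ≠ ⊥ ∧ FiniteDimensional ℂ (eigenspace T z)}

/-- The essential spectrum of a self-adjoint operator: the complement of the discrete spectrum in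
the spectrum. -/
def essentialSpectrum (T : H →ₗ.[ℂ] H) : Set ℂ := spectrum T \ discreteSpectrum T

end UnboundedOperator

end

/-! The spectrum is shown to be exactly $[0,\infty)$. This set has no isolated points, so the
discrete spectrum is empty and the essential spectrum is everything.

Upper inclusion: the form domain with inner product $\langle\chi,\psi\rangle + Q[\chi,\psi]$ is a
Hilbert space whose embedding $\iota$ into $L^2$ is a contraction, and $\iota\iota^*$ is
$(H+1)^{-1}$ (`exists_isResolventAt_neg_one`). It is positive with norm at most 1, so inverting its
spectrum and shifting by 1 lands in $[0,\infty)$ (`spectrum_subset_nonneg`).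

Lower inclusion: a Weyl argument at the level of forms. The potential decays like the inverse
distance to the fluxes, so a plane wave of momentum $(s,0)$ cut off to a far disc of size $k$ has
magnetic gradient $(s,0)\chi$ up to a relative $L^2$ error $O(1/k)$ (`exists_approx_plane_wave`). A
bounded inverse of $H-s^2$ would force such a $\chi$ to vanish (`eq_zero_of_approx_plane_wave`).
Only first derivatives enter; $H\chi$ is never computed. -/

namespace UnboundedOperator

/-! ### Spectra of unbounded operators via one resolvent -/

variable {H : Type*} [NormedAddCommGroup H] [InnerProductSpace ℂ H]

/-- A resolvent at `-1` yields a resolvent at every `z` for which `1 - (1 + z) R` is invertible. -/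
lemma IsResolventAt.of_isUnit {T : H →ₗ.[ℂ] H} {R : H →L[ℂ] H} (hR : IsResolventAt T (-1) R)
    {z : ℂ} (hz : IsUnit (1 - (1 + z) • R)) : ∃ S, IsResolventAt T z S := by
  obtain ⟨U, hU⟩ := hz
  have hl : ∀ f, (U⁻¹ : (H →L[ℂ] H)ˣ).val (f - (1 + z) • R f) = f := fun f => by
    have h := DFunLike.congr_fun U.inv_mul f
    rw [hU] at h
    simpa using h
  have hr : ∀ f, (U⁻¹ : (H →L[ℂ] H)ˣ).val f - (1 + z) • R ((U⁻¹ : (H →L[ℂ] H)ˣ).val f) = f :=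
    fun f => by
    have h := DFunLike.congr_fun U.mul_inv f
    rw [hU] at h
    simpa using h
  -- Formally $T - z = (1 - (1+z)R)(T+1)$ with $R = (T+1)^{-1}$, which dictates the inverse.
  refine ⟨R * (U⁻¹ : (H →L[ℂ] H)ˣ).val, fun f => ?_, fun ψ => ?_⟩
  · obtain ⟨hd, he⟩ := hR.1 ((U⁻¹ : (H →L[ℂ] H)ˣ).val f)
    refine ⟨hd, ?_⟩
    have h1 := hr f
    rw [neg_smul, one_smul, sub_neg_eq_add] at he
    change T ⟨R ((U⁻¹ : (H →L[ℂ] H)ˣ).val f), hd⟩ - z • R ((U⁻¹ : (H →L[ℂ] H)ˣ).val f) = f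
    rw [eq_sub_of_add_eq he]
    rw [add_smul, one_smul] at h1
    rw [sub_sub, h1]
  · have h := hR.2 ψ
    rw [neg_smul, one_smul, sub_neg_eq_add] at h
    have h2 : T ψ - z • (ψ : H) = (T ψ + ψ) - (1 + z) • R (T ψ + ψ) := by
      rw [h, add_smul, one_smul]
      abel
    rw [mul_apply_eq_comp, h2, hl, h]

/-- For a closed subspace `K` on which `ι` is a contraction into `H`: the adjoint `J` of `ι` on `K`
and the positive contraction `ι J`. -/
lemma exists_adjoint_of_contraction [CompleteSpace H] {E : Type*} [NormedAddCommGroup E]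
    [InnerProductSpace ℂ E] [CompleteSpace E] (K : Submodule ℂ E) (hK : IsClosed (K : Set E))
    (ι : E → H) (hadd : ∀ x y, ι (x + y) = ι x + ι y) (hsmul : ∀ (c : ℂ) x, ι (c • x) = c • ι x)
    (hι : ∀ x, ‖ι x‖ ≤ ‖x‖) :
    ∃ (J : H → E) (R : H →L[ℂ] H), R.IsPositive ∧ ‖R‖ ≤ 1 ∧ (∀ f, J f ∈ K) ∧
      (∀ f, R f = ι (J f)) ∧ (∀ x ∈ K, ∀ f, inner ℂ x (J f) = inner ℂ (ι x) f) := by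
  have := hK.completeSpace_coe
  set B : K →ₗ[ℂ] H :=
    { toFun := fun x => ι x, map_add' := fun x y => hadd x y, map_smul' := fun c x => hsmul c x }
  set A : K →L[ℂ] H := B.mkContinuous 1 fun x => by
    rw [one_mul]
    exact hι x
  have hA : ‖A‖ ≤ 1 := LinearMap.mkContinuous_norm_le _ zero_le_one _
  refine ⟨fun f => A.adjoint f, A ∘L A.adjoint, ContinuousLinearMap.isPositive_self_comp_adjoint A,
    ?_, fun f => (A.adjoint f).2, fun f => rfl, fun x hx f => A.adjoint_inner_right ⟨x, hx⟩ f⟩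
  have hA' : ‖A.adjoint‖ ≤ 1 := by rwa [LinearIsometryEquiv.norm_map]
  exact (ContinuousLinearMap.opNorm_comp_le _ _).trans (mul_le_one₀ hA (norm_nonneg _) hA')

open scoped ComplexOrder in
/-- An operator whose resolvent at `-1` is positive and contractive has its spectrum
in `[0, ∞)`. -/
lemma spectrum_subset_nonneg [CompleteSpace H] {T : H →ₗ.[ℂ] H} {R : H →L[ℂ] H}
    (hR : IsResolventAt T (-1) R) (hpos : R.IsPositive) (hnorm : ‖R‖ ≤ 1) :
    spectrum T ⊆ {z : ℂ | 0 ≤ z.re ∧ z.im = 0} := by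
  intro z hz
  have hu : ¬ IsUnit (1 - (1 + z) • R) := fun h => hz (hR.of_isUnit h)
  have hz1 : 1 + z ≠ 0 := fun h => hu (by simp [h])
  -- Spectral mapping for the resolvent; positivity and $\|R\| \le 1$ then place $(1+z)^{-1}$ in
  -- $(0,1]$, that is, $1+z \ge 1$.
  have hmem : (1 + z)⁻¹ ∈ _root_.spectrum ℂ R := by
    rw [_root_.spectrum.mem_iff]
    intro h
    apply hu
    have h3 : (1 - (1 + z) • R) =
        algebraMap ℂ (H →L[ℂ] H) (1 + z) * (algebraMap ℂ (H →L[ℂ] H) (1 + z)⁻¹ - R) := by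
      rw [mul_sub, ← map_mul, mul_inv_cancel₀ hz1, map_one, Algebra.smul_def]
    rw [h3]
    exact ((IsUnit.mk0 _ hz1).map _).mul h
  have h0 : 0 ≤ (1 + z)⁻¹ :=
    spectrum_nonneg_of_nonneg ((ContinuousLinearMap.nonneg_iff_isPositive R).2 hpos) hmem
  have h1 : ‖(1 + z)⁻¹‖ ≤ 1 := by
    rcases subsingleton_or_nontrivial H with hs | hs
    · exact absurd (isUnit_of_subsingleton _) hu
    · exact (_root_.spectrum.norm_le_norm_of_mem hmem).trans hnorm
  rw [norm_inv] at h1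
  have h2 : 0 ≤ 1 + z := by simpa using inv_nonneg_of_nonneg h0
  have h4 : 1 ≤ ‖1 + z‖ := by
    have := norm_pos_iff.2 hz1
    exact (inv_le_one₀ this).1 h1
  obtain ⟨ha, hb⟩ := Complex.le_def.1 h2
  have h5 : ‖1 + z‖ = (1 + z).re := Complex.re_eq_norm.2 h2 |>.symm
  rw [h5] at h4
  simp at h4 hb
  exact ⟨h4, hb.symm⟩

/-- An unbounded operator with spectrum `[0, ∞)` has no discrete spectrum. -/
lemma discreteSpectrum_eq_empty {T : H →ₗ.[ℂ] H}
    (h : spectrum T = {z : ℂ | 0 ≤ z.re ∧ z.im = 0}) : discreteSpectrum T = ∅ := by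
  refine Set.eq_empty_of_forall_notMem fun z hz => ?_
  obtain ⟨hz, ⟨ε, hε, hiso⟩, -⟩ := hz
  rw [h] at hz hiso
  -- A nearby point to the right is again in the spectrum, against isolation.
  have hw : z + (ε / 2 : ℝ) = z := by
    refine hiso _ ⟨?_, ?_⟩ ?_
    · have := hz.1
      simp only [Complex.add_re, Complex.ofReal_re]
      positivity
    · simpa using hz.2
    · rw [dist_eq_norm, add_sub_cancel_left, Complex.norm_real, Real.norm_of_nonneg (by positivity)]
      linarith
  have : (ε / 2 : ℝ) = 0 := by simpa using hw
  linarith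

end UnboundedOperator

namespace AharonovBohm

variable {N : ℕ} (α : Fin N → ℝ) (pos : Fin N → Plane)

/-! ### The form domain as a Hilbert space and the resolvent at $-1$ -/

/-- The space `L² × (L²)²` as a Hilbert space. -/
abbrev GraphSpace : Type := WithLp 2 (L2 × PiLp 2 fun _ : Fin 2 => L2)

/-- The form domain, for the inner product `⟨χ, ψ⟩ + Q_N^{(F)}[χ, ψ]`. -/
noncomputable def formSpace : Submodule ℂ GraphSpace where
  carrier := {x | (x.ofLp.1, x.ofLp.2.ofLp) ∈ formGraph α pos}
  zero_mem' := (formGraph α pos).zero_mem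
  add_mem' h h' := (formGraph α pos).add_mem h h'
  smul_mem' c _ h := (formGraph α pos).smul_mem c h

/-- The closure was taken for the sup norm of the product; the Hilbert norm is different but induces
the same topology. -/
lemma isClosed_formSpace : IsClosed (formSpace α pos : Set GraphSpace) := by
  have hG : IsClosed (formGraph α pos : Set (L2 × (Fin 2 → L2))) :=
    Submodule.isClosed_topologicalClosure _
  refine hG.preimage (f := fun x : GraphSpace => (x.ofLp.1, x.ofLp.2.ofLp)) ?_
  have h := (WithLp.prodContinuousLinearEquiv 2 ℂ L2 (PiLp 2 fun _ : Fin 2 => L2)).continuous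
  exact (continuous_fst.comp h).prodMk
    ((PiLp.continuousLinearEquiv 2 ℂ fun _ : Fin 2 => L2).continuous.comp (continuous_snd.comp h))

lemma inner_graphSpace (x y : GraphSpace) :
    inner ℂ x y = inner ℂ x.ofLp.1 y.ofLp.1 +
      ∑ j, inner ℂ (x.ofLp.2.ofLp j) (y.ofLp.2.ofLp j) := by
  rw [WithLp.prod_inner_apply, PiLp.inner_apply]

/-- The Friedrichs realization has a positive contractive resolvent at `-1`. -/
lemma exists_isResolventAt_neg_one : ∃ R : L2 →L[ℂ] L2, R.IsPositive ∧ ‖R‖ ≤ 1 ∧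
    UnboundedOperator.IsResolventAt (friedrichs α pos) (-1) R := by
  obtain ⟨J, R, hpos, hnorm, hJmem, hRJ, hJ⟩ := UnboundedOperator.exists_adjoint_of_contraction
    (formSpace α pos) (isClosed_formSpace α pos) (fun x => x.ofLp.1) (fun _ _ => rfl)
    (fun _ _ => rfl) (fun x => WithLp.norm_fst_le (p := 2) (x := x))
  -- `J f` is the Riesz representative of $\chi \mapsto \langle\chi, f\rangle$ for the form inner
  -- product; moving the $L^2$ term to the right gives the weak equation $HRf = f - Rf$.
  have hJ1 : ∀ f χ u, (χ, u) ∈ formGraph α pos →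
      ∑ j, inner ℂ (u j) ((J f).ofLp.2.ofLp j) = inner ℂ χ (f - R f) := fun f χ u hu => by
    have h := hJ (WithLp.toLp 2 (χ, WithLp.toLp 2 u)) hu f
    rw [inner_graphSpace] at h
    rw [inner_sub_right, hRJ]
    exact eq_sub_of_add_eq' h
  have hg : ∀ ψ : (friedrichs α pos).domain,
      ((ψ : L2), friedrichs α pos ψ) ∈ friedrichsGraph α pos := fun ψ => by
    rw [← graph_friedrichs]
    exact (friedrichs α pos).mem_graph ψ
  refine ⟨R, hpos, hnorm, fun f => ?_, fun ψ => ?_⟩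
  · have hmem : (R f, f - R f) ∈ (friedrichs α pos).graph := by
      rw [graph_friedrichs]
      refine ⟨(J f).ofLp.2.ofLp, ?_, hJ1 f⟩
      rw [hRJ]
      exact hJmem f
    obtain ⟨ψ, h1, h2⟩ := (LinearPMap.mem_graph_iff _).1 hmem
    simp only at h1 h2
    refine ⟨h1 ▸ ψ.2, ?_⟩
    have h3 : (⟨R f, h1 ▸ ψ.2⟩ : (friedrichs α pos).domain) = ψ := Subtype.ext h1.symm
    rw [h3, h2]
    simp
  · obtain ⟨v, hv, h⟩ := hg ψ
    set f := friedrichs α pos ψ - (-1 : ℂ) • (ψ : L2) with hf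
    -- Uniqueness in Riesz: both vectors have the same inner product with every element of the form
    -- space, in particular with their difference.
    have hy : J f - WithLp.toLp 2 ((ψ : L2), WithLp.toLp 2 v) = 0 := by
      have hmem := (formSpace α pos).sub_mem (hJmem f)
        (show WithLp.toLp 2 ((ψ : L2), WithLp.toLp 2 v) ∈ formSpace α pos from hv)
      refine (inner_self_eq_zero (𝕜 := ℂ)).1 ?_
      set x := J f - WithLp.toLp 2 ((ψ : L2), WithLp.toLp 2 v)
      have hx := h x.ofLp.1 x.ofLp.2.ofLp hmem
      have e1 : inner ℂ x (J f) = inner ℂ x.ofLp.1 (friedrichs α pos ψ) + inner ℂ x.ofLp.1 ψ := by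
        rw [hJ x hmem, hf, neg_smul, one_smul, sub_neg_eq_add, inner_add_right]
      have e2 : inner ℂ x (WithLp.toLp 2 ((ψ : L2), WithLp.toLp 2 v)) =
          inner ℂ x.ofLp.1 ψ + inner ℂ x.ofLp.1 (friedrichs α pos ψ) := by
        rw [inner_graphSpace]
        exact congrArg _ hx
      calc inner ℂ x x = inner ℂ x (J f) - inner ℂ x (WithLp.toLp 2 ((ψ : L2), WithLp.toLp 2 v)) :=
            inner_sub_right _ _ _
        _ = 0 := by rw [e1, e2]; ring
    rw [hRJ, sub_eq_zero.1 hy]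

lemma spectrum_friedrichs_subset :
    UnboundedOperator.spectrum (friedrichs α pos) ⊆ {z : ℂ | 0 ≤ z.re ∧ z.im = 0} := by
  obtain ⟨R, hpos, hnorm, hR⟩ := exists_isResolventAt_neg_one α pos
  exact UnboundedOperator.spectrum_subset_nonneg hR hpos hnorm

/-! ### Weyl criterion for the quadratic form -/

/-- The components of the magnetic gradient are symmetric on test functions. -/
lemma integral_inner_magGradient {φ ψ : Plane → ℂ} (hφ : IsTestFunction pos φ)
    (hψ : IsTestFunction pos ψ) (j : Fin 2) :
    ∫ x, inner ℂ (magGradient α pos φ j x) (ψ x) = ∫ x, inner ℂ (φ x) (magGradient α pos ψ j x) := by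
  set e : Plane := EuclideanSpace.single j 1
  set c : Plane → ℂ := fun x => starRingEnd ℂ (φ x)
  have hcd : ContDiff ℝ ∞ c := Complex.conjCLE.contDiff.comp hφ.1
  have hcs : HasCompactSupport c := hφ.2.comp_left (g := starRingEnd ℂ) (map_zero _)
  have hfc : ∀ x, fderiv ℝ c x e = starRingEnd ℂ (fderiv ℝ φ x e) := fun x => by
    have h := (Complex.conjCLE.toContinuousLinearMap.hasFDerivAt.comp x
      (hφ.1.differentiable (by simp) x).hasFDerivAt).fderiv
    exact DFunLike.congr_fun h e
  have hd : ∀ {f : Plane → ℂ}, ContDiff ℝ ∞ f → Continuous fun x => fderiv ℝ f x e := fun hf =>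
    (hf.continuous_fderiv (by simp)).clm_apply continuous_const
  have i1 : Integrable (fun x => fderiv ℝ c x e * ψ x) :=
    ((hd hcd).mul hψ.1.continuous).integrable_of_hasCompactSupport hψ.2.mul_left
  have i2 : Integrable (fun x => c x * fderiv ℝ ψ x e) :=
    (hcd.continuous.mul (hd hψ.1)).integrable_of_hasCompactSupport hcs.mul_right
  have i3 : Integrable (fun x => c x * ψ x) :=
    (hcd.continuous.mul hψ.1.continuous).integrable_of_hasCompactSupport hcs.mul_right
  have hparts := integral_mul_fderiv_eq_neg_fderiv_mul_of_integrable i1 i2 i3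
    (fun x _ => hcd.differentiable (by simp) x) (fun x _ => hψ.1.differentiable (by simp) x)
  have i4 : Integrable (fun x => inner ℂ (φ x) (magGradient α pos ψ j x)) := by
    have hc : Continuous fun x => inner ℂ (φ x) (magGradient α pos ψ j x) :=
      hφ.1.continuous.inner (continuous_magGradient α pos hψ j)
    refine hc.integrable_of_hasCompactSupport (hφ.2.mono fun x hx h0 => hx ?_)
    simp [h0]
  -- The real potential contributes equally to both sides; what remains is
  -- $i\,\partial_j(\bar\varphi\psi)$, whose integral vanishes by parts.
  have key : ∀ x, inner ℂ (magGradient α pos φ j x) (ψ x) = inner ℂ (φ x) (magGradient α pos ψ j x)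
      + Complex.I * (fderiv ℝ c x e * ψ x + c x * fderiv ℝ ψ x e) := fun x => by
    rw [hfc]
    simp only [RCLike.inner_apply, magGradient, map_add, map_mul, map_neg, Complex.conj_I,
      Complex.conj_ofReal, c, e]
    ring
  simp_rw [key]
  rw [integral_add i4 (by exact (i1.add i2).const_mul _), integral_const_mul]
  rw [integral_add i1 i2, hparts]
  simp

/-- The components of the magnetic gradient on the form domain are symmetric. -/
lemma inner_magGradient_eq {χ g : L2} {u v : Fin 2 → L2} (hχ : (χ, u) ∈ minimalGraph α pos)
    (hg : (g, v) ∈ formGraph α pos) (j : Fin 2) : inner ℂ (u j) g = inner ℂ χ (v j) := by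
  -- With $\chi$ and $u$ fixed, both sides are continuous in the graph topology, so the identity
  -- extends from test functions to their closure.
  have hclosed : IsClosed {p : L2 × (Fin 2 → L2) | inner ℂ (u j) p.1 = inner ℂ χ (p.2 j)} :=
    isClosed_eq (continuous_const.inner continuous_fst)
      (continuous_const.inner ((continuous_apply j).comp continuous_snd))
  refine closure_minimal (s := (minimalGraph α pos : Set (L2 × (Fin 2 → L2)))) ?_ hclosed hg
  rintro p ⟨ψ, hψ, k1, k2⟩
  obtain ⟨φ, hφ, h1, h2⟩ := hχ
  change inner ℂ (u j) p.1 = inner ℂ χ (p.2 j)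
  rw [L2.inner_def, L2.inner_def]
  refine (integral_congr_ae ?_).trans ((integral_inner_magGradient α pos hφ hψ j).trans
    (integral_congr_ae ?_))
  · filter_upwards [h2 j, k1] with x hx hx'
    rw [hx, hx']
  · filter_upwards [h1, k2 j] with x hx hx'
    rw [hx, hx']

/-- The estimate behind the Weyl criterion for quadratic forms: if `g` solves the weak equation
`(∑ⱼ uⱼ* vⱼ - s²) g = χ` with a bound `r` and `χ` is an approximate plane wave of momentum `(s, 0)`,
then `χ = 0`. -/
lemma eq_zero_of_approx_plane_wave {H : Type*} [NormedAddCommGroup H] [InnerProductSpace ℂ H]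
    {χ g : H} {u v : Fin 2 → H} {s r ε : ℝ} (hs : 0 ≤ s) (hr : 0 ≤ r) (hε0 : 0 ≤ ε)
    (hε : ε * (s * r + 2 * (r + s ^ 2 * r ^ 2 + 1)) ≤ 1 / 2) (hgr : ‖g‖ ≤ r * ‖χ‖)
    (hgv : ∑ j, inner ℂ (v j) (v j) = inner ℂ g (χ + ((s ^ 2 : ℝ) : ℂ) • g))
    (huv : ∑ j, inner ℂ (u j) (v j) = inner ℂ χ (χ + ((s ^ 2 : ℝ) : ℂ) • g))
    (hsym : inner ℂ (u 0) g = inner ℂ χ (v 0)) (h0 : ‖u 0 - (s : ℂ) • χ‖ ≤ ε * ‖χ‖)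
    (h1 : ‖u 1‖ ≤ ε * ‖χ‖) : χ = 0 := by
  by_contra hχ0
  set m := ‖χ‖
  have hm : 0 < m := norm_pos_iff.2 hχ0
  set D := r + s ^ 2 * r ^ 2 + 1 with hDdef
  have hD : 1 ≤ D := by
    have : 0 ≤ r + s ^ 2 * r ^ 2 := by positivity
    linarith
  -- The weak equation tested on $g$ itself bounds $\sum_j\|v_j\|^2$ by $(D-1)m^2$; the inequality
  -- $D - 1 \le D^2$ avoids a square root.
  have hvj : ∀ j, ‖v j‖ ≤ D * m := fun j => by
    have e2 : (∑ j, ‖v j‖ ^ 2 : ℝ) ≤ ‖g‖ * ‖χ + ((s ^ 2 : ℝ) : ℂ) • g‖ := by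
      have e3 : ((∑ j, ‖v j‖ ^ 2 : ℝ) : ℂ) = inner ℂ g (χ + ((s ^ 2 : ℝ) : ℂ) • g) := by
        rw [← hgv]
        push_cast
        exact Finset.sum_congr rfl fun j _ => (inner_self_eq_norm_sq_to_K (v j)).symm
      calc (∑ j, ‖v j‖ ^ 2 : ℝ) = ‖((∑ j, ‖v j‖ ^ 2 : ℝ) : ℂ)‖ := by
            rw [Complex.norm_real, Real.norm_of_nonneg (by positivity)]
        _ ≤ _ := e3 ▸ norm_inner_le_norm _ _
    have e4 : ‖v j‖ ^ 2 ≤ ∑ j, ‖v j‖ ^ 2 :=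
      Finset.single_le_sum (f := fun j => ‖v j‖ ^ 2) (fun i _ => by positivity) (Finset.mem_univ j)
    have e5 : ‖χ + ((s ^ 2 : ℝ) : ℂ) • g‖ ≤ m + s ^ 2 * (r * m) := by
      refine (norm_add_le _ _).trans ?_
      rw [norm_smul, Complex.norm_real, Real.norm_of_nonneg (by positivity)]
      gcongr
    have e6 : ‖v j‖ ^ 2 ≤ (D * m) ^ 2 := by
      calc ‖v j‖ ^ 2 ≤ ‖g‖ * ‖χ + ((s ^ 2 : ℝ) : ℂ) • g‖ := e4.trans e2
        _ ≤ (r * m) * (m + s ^ 2 * (r * m)) := by gcongr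
        _ = (D - 1) * m ^ 2 := by rw [hDdef]; ring
        _ ≤ D ^ 2 * m ^ 2 := mul_le_mul_of_nonneg_right (by nlinarith) (by positivity)
        _ = (D * m) ^ 2 := by ring
    exact le_of_sq_le_sq e6 (by positivity)
  -- Put $u_0 = s\chi + e$. Symmetry gives $\langle\chi,v_0\rangle = s\langle\chi,g\rangle + \langle
  -- e,g\rangle$, so $s^2\langle\chi,g\rangle$ cancels in the weak equation and each surviving term
  -- contains $e$ or $u_1$, both small.
  have hid : inner ℂ χ χ = (s : ℂ) * inner ℂ (u 0 - (s : ℂ) • χ) g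
      + (inner ℂ (u 0 - (s : ℂ) • χ) (v 0) + inner ℂ (u 1) (v 1)) := by
    rw [Fin.sum_univ_two, inner_add_right, inner_smul_right] at huv
    simp only [inner_sub_left, inner_smul_left, Complex.conj_ofReal]
    rw [hsym, ← sub_eq_iff_eq_add.2 huv]
    push_cast
    ring
  have hle : m ^ 2 ≤ s * ((ε * m) * (r * m)) + ((ε * m) * (D * m) + (ε * m) * (D * m)) := by
    calc m ^ 2 = ‖inner ℂ χ χ‖ := by rw [inner_self_eq_norm_sq_to_K]; simp [m]
      _ ≤ s * (‖u 0 - (s : ℂ) • χ‖ * ‖g‖) + (‖u 0 - (s : ℂ) • χ‖ * ‖v 0‖ + ‖u 1‖ * ‖v 1‖) := by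
        rw [hid]
        refine (norm_add_le _ _).trans (add_le_add ?_ ((norm_add_le _ _).trans
          (add_le_add (norm_inner_le_norm _ _) (norm_inner_le_norm _ _))))
        rw [norm_mul, Complex.norm_real, Real.norm_of_nonneg hs]
        gcongr
        exact norm_inner_le_norm _ _
      _ ≤ _ := by
        have := hvj 0
        have := hvj 1
        gcongr
  -- The bound reads $m^2 \le \varepsilon(sr + 2D)m^2 \le m^2/2$, impossible for $m > 0$.
  nlinarith [pow_pos hm 2, mul_le_mul_of_nonneg_right hε (sq_nonneg m)]

/-- Approximate plane waves of momentum `(s, 0)` in the form domain show that `s²` is in the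
spectrum. -/
lemma sq_mem_spectrum_of_approx {s : ℝ} (hs : 0 ≤ s)
    (h : ∀ ε > 0, ∃ χ u, (χ, u) ∈ minimalGraph α pos ∧ χ ≠ 0 ∧
      ‖u 0 - (s : ℂ) • χ‖ ≤ ε * ‖χ‖ ∧ ‖u 1‖ ≤ ε * ‖χ‖) :
    ((s ^ 2 : ℝ) : ℂ) ∈ UnboundedOperator.spectrum (friedrichs α pos) := by
  rintro ⟨R, hR, -⟩
  obtain ⟨r, hr, hRr⟩ : ∃ r, 0 ≤ r ∧ ∀ χ, ‖R χ‖ ≤ r * ‖χ‖ := ⟨‖R‖, norm_nonneg R, R.le_opNorm⟩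
  have hD : 0 < s * r + 2 * (r + s ^ 2 * r ^ 2 + 1) := by positivity
  obtain ⟨χ, u, hp, hχ0, h0, h1⟩ := h (1 / 2 / (s * r + 2 * (r + s ^ 2 * r ^ 2 + 1)))
    (by positivity)
  obtain ⟨hd, hTg⟩ := hR χ
  have hmem : (R χ, friedrichs α pos ⟨R χ, hd⟩) ∈ friedrichsGraph α pos := by
    rw [← graph_friedrichs]
    exact (friedrichs α pos).mem_graph ⟨R χ, hd⟩
  rw [sub_eq_iff_eq_add.1 hTg] at hmem
  obtain ⟨v, hv, hform⟩ := hmem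
  exact hχ0 (eq_zero_of_approx_plane_wave hs hr (by positivity) (div_mul_cancel₀ _ hD.ne').le
    (hRr χ) (hform _ v hv) (hform χ u ((minimalGraph α pos).le_topologicalClosure hp))
    (inner_magGradient_eq α pos hp hv 0) h0 h1)

/-! ### Cut-off plane waves far from the fluxes -/

lemma norm_perp (v : Plane) : ‖perp v‖ = ‖v‖ := by
  simp [EuclideanSpace.norm_eq, perp, Fin.sum_univ_two, add_comm]

/-- The vector potential decays like the inverse of the distance to the fluxes. -/
lemma abs_potential_le {k : ℝ} (hk : 0 < k) {x : Plane} (hx : ∀ n, k ≤ ‖x - pos n‖) (j : Fin 2) :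
    |potential α pos x j| ≤ (∑ n, |α n|) / k := by
  calc |potential α pos x j| ≤ ‖potential α pos x‖ := PiLp.norm_apply_le (potential α pos x) j
    _ ≤ ∑ n, ‖fluxPotential (α n) (pos n) x‖ := norm_sum_le _ _
    _ ≤ ∑ n, |α n| / k := Finset.sum_le_sum fun n _ => by
      have hd : 0 < ‖x - pos n‖ := hk.trans_le (hx n)
      rw [fluxPotential, norm_smul, norm_perp, norm_div, norm_pow, norm_norm, Real.norm_eq_abs]
      calc |α n| / ‖x - pos n‖ ^ 2 * ‖x - pos n‖ = |α n| / ‖x - pos n‖ := by field_simp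
        _ ≤ |α n| / k := by gcongr; exact hx n
    _ = (∑ n, |α n|) / k := by rw [Finset.sum_div]

/-- The discs of radius `2 k` about this point have distance at least `k` from the fluxes. -/
lemma exists_far_center (k : ℝ) :
    ∃ y : Plane, ∀ x ∈ Metric.closedBall y (2 * k), ∀ n, k ≤ ‖x - pos n‖ := by
  set M := ∑ n, ‖pos n‖
  have hM : ∀ n, ‖pos n‖ ≤ M := fun n =>
    Finset.single_le_sum (f := fun n => ‖pos n‖) (fun i _ => norm_nonneg _) (Finset.mem_univ n)
  -- Of the length $3k + M$, at most $2k$ is lost to the radius of the disc and at most $M$ to the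
  -- position of a flux.
  refine ⟨EuclideanSpace.single 0 (3 * k + M), fun x hx n => ?_⟩
  set y : Plane := EuclideanSpace.single 0 (3 * k + M)
  have hy : 3 * k + M ≤ ‖y‖ := by
    simp only [y, PiLp.norm_single, Real.norm_eq_abs]
    exact le_abs_self _
  rw [mem_closedBall_iff_norm] at hx
  have h1 : ‖y‖ ≤ ‖x - y‖ + ‖x - pos n‖ + ‖pos n‖ := by
    calc ‖y‖ = ‖-(x - y) + (x - pos n) + pos n‖ := by congr 1; abel
      _ ≤ ‖-(x - y)‖ + ‖x - pos n‖ + ‖pos n‖ :=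
        (norm_add_le _ _).trans (add_le_add_left (norm_add_le _ _) _)
      _ = _ := by rw [norm_neg]
  linarith [hM n]

/-- Comparison of `L²` norms of functions concentrated on concentric discs. -/
lemma eLpNorm_le_of_bound_closedBall {h φ : Plane → ℂ} {y : Plane} {k C : ℝ} (hk : 0 < k)
    (hh : ∀ x ∈ Metric.closedBall y (2 * k), ‖h x‖ ≤ C)
    (hh0 : ∀ x ∉ Metric.closedBall y (2 * k), h x = 0)
    (hφ : ∀ x ∈ Metric.closedBall y k, ‖φ x‖ = 1) :
    eLpNorm h 2 volume ≤ ENNReal.ofReal (2 * C) * eLpNorm φ 2 volume := by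
  have hC : 0 ≤ C := (norm_nonneg _).trans (hh y (Metric.mem_closedBall_self (by positivity)))
  have h1 : eLpNorm h 2 volume ≤
      eLpNorm ((Metric.closedBall y (2 * k)).indicator fun _ => C) 2 volume := by
    refine eLpNorm_mono_real fun x => ?_
    by_cases hx : x ∈ Metric.closedBall y (2 * k)
    · rw [Set.indicator_of_mem hx]
      exact hh x hx
    · rw [Set.indicator_of_notMem hx, hh0 x hx, norm_zero]
  have h2 : eLpNorm ((Metric.closedBall y k).indicator fun _ => (1 : ℝ)) 2 volume ≤
      eLpNorm φ 2 volume := by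
    refine eLpNorm_mono fun x => ?_
    by_cases hx : x ∈ Metric.closedBall y k
    · rw [Set.indicator_of_mem hx, hφ x hx, norm_one]
    · rw [Set.indicator_of_notMem hx, norm_zero]
      exact norm_nonneg _
  -- Doubling the radius multiplies the area by 4, hence the $L^2$ norm of a constant by 2: the
  -- factor in $2C$.
  have hv : volume (Metric.closedBall y (2 * k)) =
      ENNReal.ofReal 2 ^ (2 : ℝ) * volume (Metric.closedBall y k) := by
    rw [Measure.addHaar_closedBall _ _ (by positivity), Measure.addHaar_closedBall _ _ hk.le,
      mul_pow, ENNReal.ofReal_mul (by positivity), mul_assoc, ENNReal.ofReal_pow zero_le_two,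
      finrank_euclideanSpace_fin, ENNReal.rpow_two]
  rw [eLpNorm_indicator_const Metric.isClosed_closedBall.measurableSet (by norm_num) (by norm_num)]
    at h1 h2
  rw [hv, ENNReal.mul_rpow_of_nonneg _ _ (by positivity), ← ENNReal.rpow_mul] at h1
  refine h1.trans ((le_of_eq ?_).trans (mul_le_mul_right h2 _))
  rw [ENNReal.ofReal_mul (by positivity), Real.enorm_eq_ofReal hC]
  norm_num
  ring

/-- Approximate plane waves of momentum `(s, 0)`. -/
lemma exists_approx_plane_wave (s : ℝ) : ∃ C, ∀ k ≥ 1, ∃ (φ : Plane → ℂ) (y : Plane),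
    IsTestFunction pos φ ∧ (∀ x ∈ Metric.closedBall y k, ‖φ x‖ = 1) ∧
    (∀ x ∉ Metric.closedBall y (2 * k), φ x = 0) ∧
    ∀ j, ∀ x ∈ Metric.closedBall y (2 * k),
      ‖magGradient α pos φ j x - (if j = 0 then (s : ℂ) else 0) * φ x‖ ≤ C / k := by
  -- The cutoff is 1 on the unit disc and 0 beyond radius 2; rescaling by $k$ divides its gradient,
  -- bounded by `C`, by $k$.
  let f : ContDiffBump (0 : Plane) := ⟨1, 2, one_pos, one_lt_two⟩
  have hf : ContDiff ℝ ∞ f := f.contDiff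
  obtain ⟨C, hC⟩ := (f.hasCompactSupport.fderiv (𝕜 := ℝ)).exists_bound_of_continuous
    (hf.continuous_fderiv (by simp))
  refine ⟨C + ∑ n, |α n|, fun k hk1 => ?_⟩
  have hk : 0 < k := by linarith
  obtain ⟨y, hy⟩ := exists_far_center pos k
  set φ : Plane → ℂ := fun x =>
    (f (k⁻¹ • (x - y)) : ℂ) * Complex.exp (Complex.I * (s * (x 0 : ℝ) : ℝ)) with hφdef
  have hexp : ∀ x : Plane, ‖Complex.exp (Complex.I * (s * (x 0 : ℝ) : ℝ))‖ = 1 := fun x => by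
    rw [mul_comm]
    exact Complex.norm_exp_ofReal_mul_I _
  have hout : ∀ x ∉ Metric.closedBall y (2 * k), φ x = 0 := fun x hx => by
    have : f (k⁻¹ • (x - y)) = 0 := f.zero_of_le_dist (by
      rw [mem_closedBall_iff_norm, not_le] at hx
      rw [dist_zero_right, norm_smul, norm_inv, Real.norm_of_nonneg hk.le, ← div_eq_inv_mul,
        le_div_iff₀ hk]
      exact hx.le)
    simp [hφdef, this]
  have hsupp : tsupport φ ⊆ Metric.closedBall y (2 * k) :=
    closure_minimal (fun x hx => by_contra fun hn => hx (hout x hn)) Metric.isClosed_closedBall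
  have hfs : ContDiff ℝ ∞ fun x : Plane => f (k⁻¹ • (x - y)) :=
    hf.comp (g := f) (by fun_prop)
  have hlin : ContDiff ℝ ∞ fun x : Plane => s * x 0 := by fun_prop
  have hes : ContDiff ℝ ∞ fun x : Plane => Complex.exp (Complex.I * (s * (x 0 : ℝ) : ℝ)) :=
    (contDiff_const.mul (Complex.ofRealCLM.contDiff.comp hlin)).cexp
  refine ⟨φ, y, ⟨(Complex.ofRealCLM.contDiff.comp hfs).mul hes, ?_, fun n hn => ?_⟩, ?_, hout, ?_⟩
  · exact HasCompactSupport.of_support_subset_isCompact (isCompact_closedBall y (2 * k))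
      (subset_closure.trans hsupp)
  · have := hy _ (hsupp hn) n
    rw [sub_self, norm_zero] at this
    linarith
  · intro x hx
    have : f (k⁻¹ • (x - y)) = 1 := f.one_of_mem_closedBall (by
      rw [mem_closedBall_iff_norm] at hx
      rw [mem_closedBall_zero_iff, norm_smul, norm_inv, Real.norm_of_nonneg hk.le, ← div_eq_inv_mul,
        div_le_iff₀ hk, one_mul]
      exact hx)
    simp only [hφdef, this, norm_mul, hexp]
    simp
  · intro j x hx
    set e : Plane := EuclideanSpace.single j 1
    have hfd : HasFDerivAt (fun x : Plane => f (k⁻¹ • (x - y)))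
        ((fderiv ℝ f (k⁻¹ • (x - y))).comp (k⁻¹ • ContinuousLinearMap.id ℝ Plane)) x :=
      (hf.differentiable (by simp) _).hasFDerivAt.comp x
        (((hasFDerivAt_id x).sub_const y).const_smul k⁻¹)
    have hed : HasFDerivAt (fun x : Plane => Complex.exp (Complex.I * (s * (x 0 : ℝ) : ℝ)))
        (Complex.exp (Complex.I * (s * (x 0 : ℝ) : ℝ)) • (Complex.I • Complex.ofRealCLM.comp
          (s • (EuclideanSpace.proj 0 : Plane →L[ℝ] ℝ)))) x :=
      ((Complex.ofRealCLM.hasFDerivAt.comp x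
        ((EuclideanSpace.proj 0 : Plane →L[ℝ] ℝ).hasFDerivAt.const_mul s)).const_mul
          Complex.I).cexp
    have hφd := ((Complex.ofRealCLM.hasFDerivAt.comp x hfd).mul hed).fderiv
    -- Differentiating the exponential produces exactly the subtracted momentum, leaving the cutoff
    -- gradient and the potential, each of order $1/k$.
    have hmag : magGradient α pos φ j x - (if j = 0 then (s : ℂ) else 0) * φ x =
        Complex.exp (Complex.I * (s * (x 0 : ℝ) : ℝ)) *
          (-Complex.I * (k⁻¹ * fderiv ℝ f (k⁻¹ • (x - y)) e : ℝ)
            + (potential α pos x j : ℂ) * f (k⁻¹ • (x - y))) := by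
      have : fderiv ℝ φ x e = _ := DFunLike.congr_fun hφd e
      rw [magGradient, this]
      fin_cases j <;> simp [e, hφdef] <;> ring_nf <;> simp
    rw [hmag, norm_mul, hexp, one_mul]
    refine (norm_add_le _ _).trans ?_
    rw [add_div]
    refine add_le_add ?_ ?_
    · have h1 : |fderiv ℝ f (k⁻¹ • (x - y)) e| ≤ C := by
        refine ((fderiv ℝ f (k⁻¹ • (x - y))).le_opNorm e).trans ?_
        simpa [e] using hC _
      rw [norm_mul, norm_neg, Complex.norm_I, one_mul, Complex.norm_real, norm_mul, norm_inv,
        Real.norm_of_nonneg hk.le, ← div_eq_inv_mul]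
      exact div_le_div_of_nonneg_right h1 hk.le
    · rw [norm_mul, Complex.norm_real, Complex.norm_real, Real.norm_of_nonneg f.nonneg]
      exact (mul_le_of_le_one_right (norm_nonneg _) f.le_one).trans
        (abs_potential_le α pos hk (hy x hx) j)

/-! ### Every nonnegative energy is in the spectrum -/

lemma nonneg_subset_spectrum_friedrichs :
    {z : ℂ | 0 ≤ z.re ∧ z.im = 0} ⊆ UnboundedOperator.spectrum (friedrichs α pos) := by
  intro z hz
  have hz' : z = ((√z.re ^ 2 : ℝ) : ℂ) := by
    rw [Real.sq_sqrt hz.1]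
    exact Complex.ext rfl hz.2
  rw [hz']
  set s := √z.re
  refine sq_mem_spectrum_of_approx α pos (Real.sqrt_nonneg _) fun ε hε => ?_
  obtain ⟨C, hC⟩ := exists_approx_plane_wave α pos s
  -- The pointwise error $C/k$ becomes a relative $L^2$ error $2C/k$ by area doubling, so $k \ge
  -- 2C/\varepsilon$ suffices.
  obtain ⟨φ, y, hφ, h1, h0, hd⟩ := hC (max 1 (2 * C / ε)) (le_max_left _ _)
  set k := max 1 (2 * C / ε)
  have hk : 0 < k := zero_lt_one.trans_le (le_max_left _ _)
  have hkε : 2 * (C / k) ≤ ε := by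
    have : 2 * C / ε ≤ k := le_max_right _ _
    rw [div_le_iff₀ hε] at this
    rw [← mul_div_assoc, div_le_iff₀ hk]
    linarith
  have hm := hφ.1.continuous.memLp_of_hasCompactSupport (p := 2) (μ := volume) hφ.2
  have hg := fun j => (continuous_magGradient α pos hφ j).memLp_of_hasCompactSupport (p := 2)
    (μ := volume) (hasCompactSupport_magGradient α pos hφ j)
  have hsupp : tsupport φ ⊆ Metric.closedBall y (2 * k) :=
    closure_minimal (fun x hx => by_contra fun hn => hx (h0 x hn)) Metric.isClosed_closedBall
  have hest : ∀ j, ‖(hg j).toLp - (if j = 0 then (s : ℂ) else 0) • hm.toLp‖ ≤ ε * ‖hm.toLp‖ := by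
    intro j
    have hb := eLpNorm_le_of_bound_closedBall hk (hd j) (fun x hx => ?_) h1
    · rw [← MemLp.toLp_const_smul, ← MemLp.toLp_sub, Lp.norm_toLp, Lp.norm_toLp]
      have := ENNReal.toReal_mono (ENNReal.mul_ne_top ENNReal.ofReal_ne_top hm.2.ne) hb
      rw [ENNReal.toReal_mul, ENNReal.toReal_ofReal'] at this
      exact this.trans (by gcongr; exact max_le hkε hε.le)
    · have hx' := notMem_tsupport_iff_eventuallyEq.1 fun h => hx (hsupp h)
      simp [magGradient, hx'.fderiv_eq, hx'.eq_of_nhds]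
  refine ⟨hm.toLp, fun j => (hg j).toLp,
    ⟨φ, hφ, hm.coeFn_toLp, fun j => (hg j).coeFn_toLp⟩, fun hzero => ?_, ?_, ?_⟩
  · have hae : φ =ᵐ[volume] fun _ => 0 := hm.coeFn_toLp.symm.trans ((Lp.eq_zero_iff_ae_eq_zero).1 hzero)
    have h00 : φ = fun _ => 0 :=
      Measure.eq_of_ae_eq hae hφ.1.continuous continuous_const
    have := h1 y (Metric.mem_closedBall_self hk.le)
    simp [h00] at this
  · simpa using hest 0
  · simpa using hest 1

end AharonovBohm

theorem mainTheorem7 (N : ℕ) (hN : 1 ≤ N) (α : Fin N → ℝ) (hα : ∀ n, α n ∈ Set.Ioo (0 : ℝ) 1)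
    (pos : Fin N → AharonovBohm.Plane) (hpos : Function.Injective pos) :
    UnboundedOperator.essentialSpectrum (AharonovBohm.friedrichs α pos) =
        {z : ℂ | 0 ≤ z.re ∧ z.im = 0} ∧
      UnboundedOperator.discreteSpectrum (AharonovBohm.friedrichs α pos) = ∅ := by
  have h := (AharonovBohm.spectrum_friedrichs_subset α pos).antisymm
    (AharonovBohm.nonneg_subset_spectrum_friedrichs α pos)
  have hd := UnboundedOperator.discreteSpectrum_eq_empty h
  exact ⟨by rw [UnboundedOperator.essentialSpectrum, hd, Set.sdiff_empty, h], hd⟩
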